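/- Consider a server with $N$ files and $K$ users, where $K > N \ge 3$. For $F\in\mathbb{Z}^+$ write $[2^F]=\{1,\dots,2^F\}$; the files $W_1,\dots,W_N$ are independent and uniformly distributed on $[2^F]$, and $\mathbf W=(W_1,\dots,W_N)$. An $(M,R,F)$ code consists of $K$ caching functions $\phi_k:[2^F]^N\to[2^{\lfloor FM\rfloor}]$, a delivery encoding function $\psi:[2^F]^N\times[N]^K\to[2^{\lfloor FR\rfloor}]$ and $K$ decoding functions $\mu_k:[2^{\lfloor FM\rfloor}]\times[2^{\lfloor FR\rfloor}]\times[N]^K\to[2^F]$. Its error probability is $$P_e=\max_{\mathbf d\in[N]^K}\Pr\Big\{\exists k:\ \mu_k\big(\phi_k(\mathbf W),\psi(\mathbf W,\mathbf d),\mathbf d\big)\ne W_{d_k}\Big\}.$$ For $R, M \ge 0$ the pair $(R,M)$ is achievable if for every $\varepsilon>0$ there exist arbitrarily large $F$ and $(M,R,F)$ codes with $P_e<\varepsilon$. For $t\in[K]$ let $$\alpha_t=\frac{K(K-t)}{(t+1)(tN-1)}-\frac{N(K-1)}{tN-1},$$ and let $t^*\in[K]$ be any minimizer of $\alpha_t$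 over $t\in[K]$. Then for every real $M$ with $\frac1K\le M\le\frac{t^*N}{K}$ the pair $(R_c(M),M)$ is achievable, where $$R_c(M)=\begin{cases}-N\left(\frac12M-1+\frac1{2K}\right), & \frac1K\le M\le\frac{N-1}{K},\\[4pt] \frac{1}{(t^*-1)N+1}\left(\frac{K(K-t^*)}{t^*+1}-N\left(K-\frac N2\right)\right)\left(M-\frac{N-1}{K}\right)+N-\frac{N^2}{2K}, & \frac{N-1}{K}\le M\le\frac{t^*N}{K}.\end{cases}$$ -/

import Mathlib

open MeasureTheory ProbabilityTheory

namespace CodedCaching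

noncomputable section

/-- An `(M, R, F)` caching and delivery code for `N` files of `F` bits each and `K` users.
The set `{1, …, 2 ^ F}` is modelled by `Fin (2 ^ F)`, and similarly for the caches and the
message; a database is a function `Fin N → Fin (2 ^ F)`, a demand vector is a function
`Fin K → Fin N`. -/
structure Code (N K : ℕ) (M R : ℝ) (F : ℕ) where
  /-- the caching functions `φ_k` -/
  cache : Fin K → (Fin N → Fin (2 ^ F)) → Fin (2 ^ ⌊(F : ℝ) * M⌋₊)
  /-- the delivery encoding function `ψ` -/
  encode : (Fin N → Fin (2 ^ F)) → (Fin K → Fin N) → Fin (2 ^ ⌊(F : ℝ) * R⌋₊)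
  /-- the decoding functions `μ_k` -/
  decode : Fin K → Fin (2 ^ ⌊(F : ℝ) * M⌋₊) → Fin (2 ^ ⌊(F : ℝ) * R⌋₊) →
    (Fin K → Fin N) → Fin (2 ^ F)

/-- The law of the database: `N` independent files, each uniformly distributed. -/
def databaseLaw (N F : ℕ) : Measure (Fin N → Fin (2 ^ F)) :=
  Measure.pi fun _ => uniformOn (Set.univ : Set (Fin (2 ^ F)))

/-- The databases for which some user fails to recover the file that it requests. -/
def Code.errorEvent {N K : ℕ} {M R : ℝ} {F : ℕ} (c : Code N K M R F) (d : Fin K → Fin N) :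
    Set (Fin N → Fin (2 ^ F)) :=
  {W | ∃ k : Fin K, c.decode k (c.cache k W) (c.encode W d) d ≠ W (d k)}

/-- The probability of error, in the worst case over all demand vectors
(a maximum over a finite set). -/
def Code.errorProb {N K : ℕ} {M R : ℝ} {F : ℕ} (c : Code N K M R F) : ℝ :=
  ⨆ d : Fin K → Fin N, (databaseLaw N F).real (c.errorEvent d)

/-- The delivery rate-cache capacity pair `(R, M)` is achievable: for every `ε > 0` there are
`(M, R, F)` codes of error probability less than `ε`, with `F` as large as desired. -/
def Achievable (N K : ℕ) (R M : ℝ) : Prop :=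
  0 ≤ R ∧ 0 ≤ M ∧
    ∀ ε : ℝ, 0 < ε → ∀ F₀ : ℕ, ∃ F : ℕ, F₀ ≤ F ∧ 0 < F ∧
      ∃ c : Code N K M R F, c.errorProb < ε

/-- The slope `α_t` of the line through the points `(1 / K, N - N / K)` and
`(t N / K, (K - t) / (t + 1))` of the cache capacity-delivery rate plane. -/
def slope (N K t : ℕ) : ℝ :=
  (K * (K - t) : ℝ) / ((t + 1) * (t * N - 1)) - (N * (K - 1) : ℝ) / (t * N - 1)

/-- `t` is a minimizer of `α_t` over `t ∈ {1, …, K}`. -/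
def IsOptimalIndex (N K t : ℕ) : Prop :=
  t ∈ Finset.Icc 1 K ∧ ∀ s ∈ Finset.Icc 1 K, slope N K t ≤ slope N K s

/-- The piecewise linear trade-off `R_c`, with breakpoint `(N - 1) / K`, where both formulas
give `N - N ^ 2 / (2 K)`. -/
def tradeoff (N K t : ℕ) (M : ℝ) : ℝ :=
  if M ≤ ((N : ℝ) - 1) / K then
    -(N : ℝ) * (1 / 2 * M - 1 + 1 / (2 * K))
  else
    1 / (((t : ℝ) - 1) * N + 1) * ((K * (K - t) : ℝ) / (t + 1) - N * (K - (N : ℝ) / 2)) *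
      (M - ((N : ℝ) - 1) / K) + N - (N : ℝ) ^ 2 / (2 * K)

end

end CodedCaching

/-!
A linear scheme serves every user without error as soon as no nonzero value of the requested file
is invisible to the cache and the message. Juxtaposing copies of linear schemes makes the set of
pairs `(M, R)` they attain convex over `ℚ`. Real weights are only limits of rational ones, and
rounding them costs a little rate; this is harmless near an interior point of the set.

Three schemes give the points `(1 / K, N - N / K)`, `(N / K, N - N (N + 1) / (2 K))` and
`(t N / K, (K - t) / (t + 1))`: users cache sums over all files, uncoded bits serving pairs of
users, or uncoded bits serving `t + 1` users at once. In a fourth, users cache sums over `N - 1`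
files; for `N ≥ 3` its point lies strictly below the segment joining the first two. The open segment
thus consists of interior points, and so does the half-open segment from its point at
`M = (N - 1) / K` towards the third point.
-/

namespace CodedCaching

open Finset

/-- A linear functional of the bits `W n a` of a database over `ZMod 2`, where `a` indexes the bits
of file `n`. -/
abbrev Functional (N : ℕ) (α : Type) : Type :=
  Module.Dual (ZMod 2) (Fin N → α → ZMod 2)

/-- The functional reading the bit `a` of file `n`. -/
def bit {N : ℕ} {α : Type} (n : Fin N) (a : α) : Functional N α :=
  LinearMap.proj a ∘ₗ LinearMap.proj n

@[simp]
theorem bit_apply {N : ℕ} {α : Type} (n : Fin N) (a : α) (W : Fin N → α → ZMod 2) :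
    bit n a W = W n a :=
  rfl

/-- When user `k` stores the functionals `cache k`, some message of at most `r` functionals serves
the demand `d`. The bits of file `n` are indexed by `S n`, and a database is extended by zero.
By linearity, decodability says that a database invisible to user `k` vanishes at file `d k`. -/
def Delivers {N K : ℕ} {α : Type} (S : Fin N → Finset α) (cache : Fin K → Finset (Functional N α))
    (r : ℕ) (d : Fin K → Fin N) : Prop :=
  ∃ msg : Finset (Functional N α), #msg ≤ r ∧
    ∀ W : Fin N → α → ZMod 2, (∀ n, ∀ a ∉ S n, W n a = 0) →
      ∀ k, (∀ f ∈ cache k, f W = 0) → (∀ f ∈ msg, f W = 0) → W (d k) = 0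

/-- There is a binary linear zero-error scheme for `N` files of `p` bits and `K` users, with
caches of at most `m` bits and messages of at most `r` bits. -/
def LinearScheme (N K p m r : ℕ) : Prop :=
  ∃ (α : Type) (S : Fin N → Finset α) (cache : Fin K → Finset (Functional N α)),
    (∀ n, #(S n) = p) ∧ (∀ k, #(cache k) ≤ m) ∧ ∀ d, Delivers S cache r d

section Combination

variable {N K p m r p' m' r' : ℕ}

theorem LinearScheme.zero (N K : ℕ) : LinearScheme N K 0 0 0 :=
  ⟨Empty, fun _ => ∅, fun _ => ∅, by simp, by simp,
    fun _ => ⟨∅, by simp, fun _ _ _ _ _ => Subsingleton.elim _ _⟩⟩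

theorem LinearScheme.add (h : LinearScheme N K p m r) (h' : LinearScheme N K p' m' r') :
    LinearScheme N K (p + p') (m + m') (r + r') := by
  classical
  obtain ⟨α, S, cache, hS, hcache, hdel⟩ := h
  obtain ⟨β, S', cache', hS', hcache', hdel'⟩ := h'
  let left : (Fin N → α ⊕ β → ZMod 2) →ₗ[ZMod 2] (Fin N → α → ZMod 2) :=
    (LinearMap.funLeft _ _ Sum.inl).compLeft _
  let right : (Fin N → α ⊕ β → ZMod 2) →ₗ[ZMod 2] (Fin N → β → ZMod 2) :=
    (LinearMap.funLeft _ _ Sum.inr).compLeft _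
  let join (s : Finset (Functional N α)) (s' : Finset (Functional N β)) :
      Finset (Functional N (α ⊕ β)) :=
    s.image (· ∘ₗ left) ∪ s'.image (· ∘ₗ right)
  have card_join {s s' b b'} (hs : #s ≤ b) (hs' : #s' ≤ b') : #(join s s') ≤ b + b' :=
    (card_union_le _ _).trans
      (add_le_add (card_image_le.trans hs) (card_image_le.trans hs'))
  have join_vanishes {s s' W} (h : ∀ f ∈ join s s', f W = 0) :
      (∀ f ∈ s, f (left W) = 0) ∧ ∀ f ∈ s', f (right W) = 0 := by
    obtain ⟨hl, hr⟩ := forall_mem_union.1 h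
    exact ⟨forall_mem_image.1 hl, forall_mem_image.1 hr⟩
  refine ⟨α ⊕ β, fun n => (S n).disjSum (S' n), fun k => join (cache k) (cache' k),
    fun n => by simp [hS, hS'], fun k => card_join (hcache k) (hcache' k), fun d => ?_⟩
  obtain ⟨msg, hmsg, hdec⟩ := hdel d
  obtain ⟨msg', hmsg', hdec'⟩ := hdel' d
  refine ⟨join msg msg', card_join hmsg hmsg', fun W hW k hc hm => ?_⟩
  have hl : left W (d k) = 0 :=
    hdec _ (fun n a ha => hW n (.inl a) (by simpa using ha)) k (join_vanishes hc).1
      (join_vanishes hm).1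
  have hr : right W (d k) = 0 :=
    hdec' _ (fun n a ha => hW n (.inr a) (by simpa using ha)) k (join_vanishes hc).2
      (join_vanishes hm).2
  exact funext (Sum.rec (congrFun hl) (congrFun hr))

theorem LinearScheme.mul (h : LinearScheme N K p m r) (b : ℕ) :
    LinearScheme N K (b * p) (b * m) (b * r) := by
  induction b with
  | zero => simpa using LinearScheme.zero N K
  | succ b ih => simpa [add_mul] using ih.add h

end Combination

section Achievability

variable {N K F : ℕ} {M R : ℝ}

theorem exists_code_errorProb_eq_zero
    (φ : Fin K → (Fin N → Fin (2 ^ F)) → Fin (2 ^ ⌊(F : ℝ) * M⌋₊))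
    (ψ : (Fin N → Fin (2 ^ F)) → (Fin K → Fin N) → Fin (2 ^ ⌊(F : ℝ) * R⌋₊))
    (h : ∀ k d W W', φ k W = φ k W' → ψ W d = ψ W' d → W (d k) = W' (d k)) :
    ∃ c : Code N K M R F, c.errorProb = 0 := by
  let c : Code N K M R F := ⟨φ, ψ, fun k x y d =>
    Function.extend (fun W => (φ k W, ψ W d)) (fun W => W (d k)) (fun _ => 0) (x, y)⟩
  have factors (k d) : (fun W => W (d k)).FactorsThrough fun W => (φ k W, ψ W d) :=
    fun W W' hW => h k d W W' (congrArg Prod.fst hW) (congrArg Prod.snd hW)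
  have no_error (d) : c.errorEvent d = ∅ :=
    Set.eq_empty_of_forall_notMem fun W ⟨k, hk⟩ => hk ((factors k d).extend_apply (fun _ => 0) W)
  exact ⟨c, by simp [Code.errorProb, no_error]⟩

theorem exists_fin_two_pow_separating {V : Type*} [AddCommGroup V] [Module (ZMod 2) V]
    {s : Finset (Module.Dual (ZMod 2) V)} {b : ℕ} (hs : #s ≤ b) :
    ∃ g : V → Fin (2 ^ b), ∀ v w, g v = g w → ∀ f ∈ s, f (v - w) = 0 := by
  classical
  obtain ⟨e⟩ : Nonempty ((s → ZMod 2) ↪ Fin (2 ^ b)) :=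
    Function.Embedding.nonempty_of_card_le (by simpa using Nat.pow_le_pow_right two_pos hs)
  refine ⟨fun v => e fun f => f.1 v, fun v w h f hf => ?_⟩
  have hfvw : f v = f w := congrFun (e.injective h) ⟨f, hf⟩
  rw [map_sub, hfvw, sub_self]

theorem LinearScheme.exists_code {m r : ℕ} (h : LinearScheme N K F m r)
    (hm : (m : ℝ) ≤ F * M) (hr : (r : ℝ) ≤ F * R) :
    ∃ c : Code N K M R F, c.errorProb = 0 := by
  classical
  obtain ⟨α, S, cache, hS, hcache, hdel⟩ := h
  choose msg hmsg hdec using hdel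
  have e (n) : Fin (2 ^ F) ≃ (S n → ZMod 2) := Fintype.equivOfCardEq (by simp [hS])
  let bits (W : Fin N → Fin (2 ^ F)) (n : Fin N) (a : α) : ZMod 2 :=
    if ha : a ∈ S n then e n (W n) ⟨a, ha⟩ else 0
  choose store hstore using fun k => exists_fin_two_pow_separating
    ((hcache k).trans (Nat.le_floor hm))
  choose send hsend using fun d => exists_fin_two_pow_separating
    ((hmsg d).trans (Nat.le_floor hr))
  refine exists_code_errorProb_eq_zero (fun k W => store k (bits W))
    (fun W d => send d (bits W)) fun k d W W' hc hd => (e (d k)).injective ?_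
  have hbits : bits W (d k) - bits W' (d k) = 0 :=
    hdec d (bits W - bits W') (fun n a ha => by simp [bits, ha]) k
      (hstore k _ _ hc) (hsend d _ _ hd)
  funext a
  simpa [bits, sub_eq_zero] using congrFun hbits a.1

/-- The pairs `(M, R)`, in this order, for which some linear scheme has caches of `M` and messages
of `R` times the file size; unlike `Achievable`, this asks for no limit in the file size. -/
def linearRegion (N K : ℕ) : Set (ℝ × ℝ) :=
  {x | ∃ p m r, 0 < p ∧ LinearScheme N K p m r ∧ (m : ℝ) ≤ p * x.1 ∧ (r : ℝ) ≤ p * x.2}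

theorem achievable_of_mem_linearRegion (h : (M, R) ∈ linearRegion N K) : Achievable N K R M := by
  obtain ⟨p, m, r, hp, h, hm, hr⟩ := h
  have hp' : (0 : ℝ) < p := by exact_mod_cast hp
  have scale {x : ℕ} {y : ℝ} (b : ℕ) (hxy : (x : ℝ) ≤ p * y) :
      ((b * x : ℕ) : ℝ) ≤ (b * p : ℕ) * y := by
    push_cast
    rw [mul_assoc]
    gcongr
  refine ⟨nonneg_of_mul_nonneg_right (r.cast_nonneg.trans hr) hp',
    nonneg_of_mul_nonneg_right (m.cast_nonneg.trans hm) hp', fun ε hε F₀ => ?_⟩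
  obtain ⟨c, hc⟩ := (h.mul (F₀ + 1)).exists_code (scale _ hm) (scale _ hr)
  exact ⟨(F₀ + 1) * p, by nlinarith, by positivity, c, by rwa [hc]⟩

end Achievability

theorem openSegment_subset_interior_of_convex_rat {E : Type*} [AddCommGroup E] [Module ℝ E]
    [Module ℚ E] [TopologicalSpace E] [IsTopologicalAddGroup E] [ContinuousSMul ℝ E] {s : Set E}
    (hs : Convex ℚ s) {x y : E} (hx : x ∈ interior s) (hy : y ∈ s) :
    openSegment ℝ x y ⊆ interior s := by
  rintro z ⟨a, b, ha, hb, hab, rfl⟩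
  obtain rfl : b = 1 - a := by linarith
  set z := a • x + (1 - a) • y
  -- `z` lies between `y` and the point `source q`, which is close to `x` if `q` is close to `a`.
  let source (q : ℝ) : E := q⁻¹ • (z - (1 - q) • y)
  have hsource : source a = x := by simp [source, z, ha.ne']
  have hcont : ContinuousAt source a := by fun_prop (disch := exact ha.ne')
  have hnear : ∀ᶠ q in nhds a, source q ∈ interior s ∧ 0 < q ∧ q < 1 :=
    (hcont.eventually_mem (by rw [hsource]; exact isOpen_interior.mem_nhds hx)).and
      ((lt_mem_nhds ha).and (gt_mem_nhds (by linarith)))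
  obtain ⟨q, hq, hq₀, hq₁⟩ := Rat.denseRange_cast.mem_nhds hnear
  have : ContinuousConstSMul ℚ E := ⟨fun q => by
    simpa only [Rat.cast_smul_eq_qsmul] using continuous_const_smul (T := E) (q : ℝ)⟩
  have hmem := hs.combo_interior_self_mem_interior hq hy (a := q) (b := 1 - q)
    (by exact_mod_cast hq₀) (by exact_mod_cast (sub_pos.2 hq₁).le) (by ring)
  convert hmem using 1
  rw [← Rat.cast_smul_eq_qsmul ℝ, ← Rat.cast_smul_eq_qsmul ℝ, smul_inv_smul₀ hq₀.ne']
  push_cast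
  abel

theorem mem_interior_of_convex_rat_of_line {s : Set (ℝ × ℝ)} (hs : Convex ℚ s)
    {x₀ y₀ c a b x z : ℝ}
    (ha : (a, y₀ + c * (a - x₀)) ∈ s) (hb : (b, y₀ + c * (b - x₀)) ∈ s)
    (hx : (x, y₀ + c * (x - x₀)) ∈ interior s) (hz : z ∈ Set.Ioo a b) :
    (z, y₀ + c * (z - x₀)) ∈ interior s := by
  have key {w : ℝ} (hw : (w, y₀ + c * (w - x₀)) ∈ s) (hzw : z ∈ openSegment ℝ x w) :
      (z, y₀ + c * (z - x₀)) ∈ interior s := by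
    refine openSegment_subset_interior_of_convex_rat hs hx hw ?_
    obtain ⟨u, v, hu, hv, huv, rfl⟩ := hzw
    refine ⟨u, v, hu, hv, huv, Prod.ext rfl ?_⟩
    simp only [Prod.smul_mk, Prod.mk_add_mk, smul_eq_mul]
    linear_combination (y₀ - c * x₀) * huv
  rcases lt_trichotomy z x with h | rfl | h
  · exact key ha (by rw [openSegment_symm, openSegment_eq_Ioo (hz.1.trans h)]; exact ⟨hz.1, h⟩)
  · exact hx
  · exact key hb (by rw [openSegment_eq_Ioo (h.trans hz.2)]; exact ⟨h, hz.2⟩)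

theorem exists_nat_weights_of_add_eq_one {a b : ℚ} (ha : 0 ≤ a) (hb : 0 ≤ b) (hab : a + b = 1) :
    ∃ i j : ℕ, 0 < i + j ∧ (i : ℚ) = (i + j) * a ∧ (j : ℚ) = (i + j) * b := by
  lift a to ℚ≥0 using ha
  obtain rfl : b = 1 - a := by linarith
  have hden : (a : ℚ) * a.den = a.num := by exact_mod_cast a.mul_den_eq_num
  have hnum : a.num ≤ a.den := by
    rw [← Nat.cast_le (α := ℚ), ← hden]
    exact mul_le_of_le_one_left (by positivity) (sub_nonneg.1 hb)
  refine ⟨a.num, a.den - a.num, by have := a.den_pos; omega, ?_, ?_⟩ <;>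
    push_cast [Nat.cast_sub hnum] <;> linarith

theorem convex_rat_linearRegion (N K : ℕ) : Convex ℚ (linearRegion N K) := by
  rintro x ⟨p, m, r, hp, h, hm, hr⟩ y ⟨p', m', r', hp', h', hm', hr'⟩ a b ha hb hab
  obtain ⟨i, j, hij, hi, hj⟩ := exists_nat_weights_of_add_eq_one ha hb hab
  have hi : (i : ℝ) = (i + j) * a := by exact_mod_cast hi
  have hj : (j : ℝ) = (i + j) * b := by exact_mod_cast hj
  have mix {u v : ℕ} {z w : ℝ} (hu : (u : ℝ) ≤ p * z) (hv : (v : ℝ) ≤ p' * w) :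
      ((i * p' * u + j * p * v : ℕ) : ℝ) ≤ (i * p' * p + j * p * p' : ℕ) * (a * z + b * w) := by
    push_cast
    calc (i * p' * u + j * p * v : ℝ) ≤ i * p' * (p * z) + j * p * (p' * w) := by gcongr
      _ = (i * p' * p + j * p * p') * (a * z + b * w) := by
        linear_combination p * p' * z * hi + p * p' * w * hj
  refine ⟨_, _, _, ?_, (h.mul (i * p')).add (h'.mul (j * p)), ?_, ?_⟩
  · calc 0 < (i + j) * (p * p') := by positivity
      _ = i * p' * p + j * p * p' := by ring
  · simpa [Rat.smul_def] using mix hm hm'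
  · simpa [Rat.smul_def] using mix hr hr'

theorem LinearScheme.mem_interior_linearRegion {N K p m r : ℕ} (h : LinearScheme N K p m r)
    (hp : 0 < p) {x : ℝ × ℝ} (hm : (m : ℝ) < p * x.1) (hr : (r : ℝ) < p * x.2) :
    x ∈ interior (linearRegion N K) := by
  have hopen : IsOpen ({x : ℝ × ℝ | (m : ℝ) < p * x.1} ∩ {x | (r : ℝ) < p * x.2}) :=
    (isOpen_lt (by fun_prop) (by fun_prop)).inter (isOpen_lt (by fun_prop) (by fun_prop))
  exact mem_interior.2
    ⟨_, fun _ hy => ⟨p, m, r, hp, h, le_of_lt hy.1, le_of_lt hy.2⟩, hopen, hm, hr⟩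

section Schemes

variable {N K : ℕ}

theorem delivers_of_not_surjective {p r : ℕ} {α : Type} (S : Fin N → Finset α)
    (cache : Fin K → Finset (Functional N α)) (hS : ∀ n, #(S n) = p) (hr : (N - 1) * p ≤ r)
    {d : Fin K → Fin N} (hd : ¬ Function.Surjective d) : Delivers S cache r d := by
  classical
  obtain ⟨a, ha⟩ := not_forall.1 hd
  refine ⟨(({a}ᶜ : Finset (Fin N)).sigma S).image fun x => bit x.1 x.2,
    card_image_le.trans ?_, fun W hW k _ hm => funext fun x => ?_⟩
  · simpa [card_sigma, hS, card_compl] using hr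
  · by_cases hx : x ∈ S (d k)
    · exact hm (bit (d k) x) (mem_image.2 ⟨⟨d k, x⟩, by simpa [hx] using fun h => ha ⟨k, h⟩, rfl⟩)
    · exact hW _ _ hx

theorem eq_zero_of_sum_eq_zero {ι κ A : Type*} [Fintype ι] [AddCommMonoid A] {X : ι → κ → A}
    {d : κ → ι} {u : ι → κ} (hclone : ∀ n j, X n j = X n (u (d j)))
    (hlead : ∀ n a, n ≠ a → X n (u a) = 0) {k : κ} (hsum : ∑ n, X n k = 0) :
    X (d k) = 0 := by
  have hself : X (d k) (u (d k)) = 0 := by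
    rw [← hsum, ← sum_eq_single_of_mem (d k) (mem_univ _) fun n _ hn => hlead n _ hn]
    exact sum_congr rfl fun n _ => (hclone n k).symm
  funext j
  rw [hclone]
  by_cases h : d k = d j
  · rw [← h, hself, Pi.zero_apply]
  · exact hlead _ _ h

theorem linearScheme_sum (hNK : N ≤ K) : LinearScheme N K K 1 (N * K - N) := by
  classical
  refine ⟨Fin K, fun _ => univ, fun k => {∑ n, bit n k}, by simp, by simp, fun d => ?_⟩
  by_cases hd : Function.Surjective d
  swap
  · refine delivers_of_not_surjective _ _ (p := K) (by simp) ?_ hd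
    rw [Nat.sub_mul, one_mul]
    omega
  obtain ⟨u, hu⟩ := hd.hasRightInverse
  let leaders : Finset (Functional N (Fin K)) := univ.offDiag.image fun x => bit x.1 (u x.2)
  let clones : Finset (Functional N (Fin K)) :=
    (univ ×ˢ (univ.image u)ᶜ).image fun x => bit x.1 x.2 - bit x.1 (u (d x.2))
  refine ⟨leaders ∪ clones, ?_, fun W _ k hc hm => ?_⟩
  · calc #(leaders ∪ clones) ≤ #leaders + #clones := card_union_le _ _
      _ ≤ (N * N - N) + N * (K - N) := by
        refine add_le_add (card_image_le.trans ?_) (card_image_le.trans ?_)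
        · simp [offDiag_card]
        · simp [card_compl, card_image_of_injective _ hu.injective]
      _ = N * K - N := by
        rw [Nat.mul_sub]
        have := Nat.mul_le_mul_left N hNK
        have := Nat.le_mul_self N
        omega
  · obtain ⟨hleaders, hclones⟩ := forall_mem_union.1 hm
    refine eq_zero_of_sum_eq_zero (u := u) (fun n j => ?_) (fun n a hna => ?_)
      (by simpa using hc)
    · by_cases hj : j ∈ univ.image u
      · obtain ⟨a, -, rfl⟩ := mem_image.1 hj
        rw [hu]
      · exact sub_eq_zero.1 (forall_mem_image.1 hclones (x := (n, j)) (by simpa using hj))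
    · exact forall_mem_image.1 hleaders (x := (n, a)) (by simpa using hna)

theorem exists_leaders {ι κ : Type*} [Fintype ι] [Fintype κ]
    (h : Fintype.card ι ≤ Fintype.card κ) (d : κ → ι) :
    ∃ L : Finset κ, #L = Fintype.card ι ∧ ∀ k, ∃ u ∈ L, d u = d k := by
  classical
  obtain ⟨L₀, -, hinj, himage⟩ := exists_subset_injOn_image_eq_of_surjOn (f := d) Set.univ
    (univ.image d) (by simp [Set.SurjOn])
  have hL₀ : #L₀ ≤ Fintype.card ι := by
    rw [← card_image_of_injOn hinj]
    exact card_le_univ _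
  obtain ⟨L, hL, -, hcard⟩ := exists_subsuperset_card_eq (subset_univ L₀) hL₀ h
  refine ⟨L, hcard, fun k => ?_⟩
  obtain ⟨u, hu, huk⟩ := mem_image.1 (himage ▸ mem_image_of_mem d (mem_univ k))
  exact ⟨u, hL hu, huk⟩

theorem eq_zero_of_pair_eq_zero {ι κ A : Type*} [AddMonoid A] {X : ι → κ → A} {d : κ → ι}
    {L : Finset κ} (hL : ∀ k, ∃ u ∈ L, d u = d k)
    (hpair : ∀ i ∈ L, ∀ j, X (d i) j + X (d j) i = 0) {k : κ} (hk : ∀ n, X n k = 0) :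
    X (d k) = 0 := by
  funext j
  obtain ⟨a, ha, hak⟩ := hL k
  obtain ⟨b, hb, hbj⟩ := hL j
  have hkb : X (d k) b = 0 := by simpa [hk] using hpair b hb k
  have hja : X (d j) a = 0 := by simpa [hak, hbj, hkb] using hpair a ha b
  simpa [hak, hja] using hpair a ha j

theorem linearScheme_pairs (hNK : N ≤ K) :
    LinearScheme N K K N (K.choose 2 - (K - N).choose 2) := by
  classical
  refine ⟨Fin K, fun _ => univ, fun k => univ.image fun n => bit n k, by simp,
    fun k => card_image_le.trans (by simp), fun d => ?_⟩
  obtain ⟨L, hL, hLd⟩ := exists_leaders (by simpa using hNK) d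
  let pairs (s : Finset (Fin K)) : Finset (Sym2 (Fin K)) := s.offDiag.image Sym2.mk.uncurry
  let exchange : Sym2 (Fin K) → Functional N (Fin K) :=
    Sym2.lift ⟨fun i j => bit (d i) j + bit (d j) i, fun _ _ => add_comm _ _⟩
  refine ⟨(pairs univ \ pairs Lᶜ).image exchange, card_image_le.trans ?_, fun W _ k hc hm => ?_⟩
  · have hsub : pairs Lᶜ ⊆ pairs univ := image_subset_image (offDiag_mono (subset_univ _))
    rw [card_sdiff_of_subset hsub, Sym2.card_image_offDiag, Sym2.card_image_offDiag]
    simp [card_compl, hL]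
  · refine eq_zero_of_pair_eq_zero hLd (fun i hi j => ?_) fun n =>
      forall_mem_image.1 hc (mem_univ n)
    rcases eq_or_ne i j with rfl | hij
    · exact CharTwo.add_self_eq_zero _
    · have hnotMem : s(i, j) ∉ pairs Lᶜ := fun h => by
        obtain ⟨⟨a, b⟩, hab, heq : s(a, b) = s(i, j)⟩ := mem_image.1 h
        obtain ⟨ha, hb, -⟩ := mem_offDiag.1 hab
        rcases Sym2.mem_iff.1 (heq ▸ Sym2.mem_mk_left i j) with rfl | rfl
        exacts [mem_compl.1 ha hi, mem_compl.1 hb hi]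
      exact forall_mem_image.1 hm (x := s(i, j)) (mem_sdiff.2
        ⟨mem_image.2 ⟨(i, j), by simpa using hij, rfl⟩, hnotMem⟩)

theorem linearScheme_subsets (N K t : ℕ) :
    LinearScheme N K (K.choose t) (N * (K - 1).choose (t - 1)) (K.choose (t + 1)) := by
  classical
  let exchange (d : Fin K → Fin N) (B : Finset (Fin K)) : Functional N (Finset (Fin K)) :=
    ∑ i ∈ B, bit (d i) (B.erase i)
  refine ⟨Finset (Fin K), fun _ => powersetCard t univ, fun k =>
    (univ ×ˢ (powersetCard (t - 1) (univ.erase k))).image fun x => bit x.1 (insert k x.2),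
    by simp, fun k => card_image_le.trans (by simp [card_erase_of_mem]), fun d =>
    ⟨(powersetCard (t + 1) univ).image (exchange d), card_image_le.trans (by simp),
      fun W hW k hc hm => funext fun A => ?_⟩⟩
  have hcached {n : Fin N} {A : Finset (Fin K)} (hkA : k ∈ A) : W n A = 0 := by
    by_cases hA : #A = t
    · have hmem : (n, A.erase k) ∈ univ ×ˢ powersetCard (t - 1) (univ.erase k) := by
        simp [mem_powersetCard, erase_subset_erase, card_erase_of_mem hkA, hA]
      simpa [insert_erase hkA] using forall_mem_image.1 hc hmem
    · exact hW n A (by simpa using hA)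
  by_cases hkA : k ∈ A
  · exact hcached hkA
  by_cases hA : #A = t
  swap
  · exact hW _ A (by simpa using hA)
  have hmsg : ∑ i ∈ insert k A, W (d i) ((insert k A).erase i) = 0 := by
    simpa [exchange] using forall_mem_image.1 hm (x := insert k A)
      (by simp [mem_powersetCard, card_insert_of_notMem hkA, hA])
  rwa [sum_insert hkA, erase_insert hkA, sum_eq_zero, add_zero] at hmsg
  intro i hi
  exact hcached (mem_erase.2 ⟨fun h => hkA (h ▸ hi), mem_insert_self _ _⟩)

theorem eq_zero_of_sum_compl_eq_zero {ι κ A : Type*} [Fintype ι] [AddCommGroup A]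
    {X : ι → κ → ι → A} {d : κ → ι} {u : ι → κ} {E : ι → A} (hdiag : ∀ n j, X n j n = 0)
    (hclone : ∀ n j m, X n j m = X n (u (d j)) m)
    (hlead : ∀ n a m, a ≠ n → a ≠ m → X n (u a) m = 0)
    (hrow : ∀ n a, a ≠ n → X n (u a) a = E n) (hE : ∑ n, E n = 0) {k : κ}
    (hsum : ∀ m, ∑ n, X n k m = 0) : X (d k) = 0 := by
  classical
  set a := d k with ha
  have hsum' (m) : ∑ n, X n (u a) m = 0 := by
    rw [← hsum m]
    exact sum_congr rfl fun n _ => (hclone n k m).symm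
  have hself (m) : X a (u a) m = 0 := by
    rcases eq_or_ne m a with rfl | hm
    · exact hdiag _ _
    · rw [← hsum' m, sum_eq_single_of_mem a (mem_univ _) fun n _ hn => hlead n a m hn.symm hm.symm]
  have hEa : E a = 0 := by
    have h := hsum' a
    rw [← add_sum_erase _ _ (mem_univ a), hdiag, zero_add,
      sum_congr rfl fun n hn => hrow n a (ne_of_mem_erase hn).symm] at h
    rwa [← add_sum_erase _ _ (mem_univ a), h, add_zero] at hE
  funext j m
  rw [hclone]
  rcases eq_or_ne (d j) a with hj | hj
  · rw [hj, hself, Pi.zero_apply, Pi.zero_apply]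
  · rcases eq_or_ne (d j) m with rfl | hm
    · rw [hrow _ _ hj, hEa, Pi.zero_apply, Pi.zero_apply]
    · exact hlead _ _ _ hj hm

theorem mul_self_le_mul_mul_pred (hN : 2 ≤ N) (hNK : N ≤ K) : N * N ≤ N * (K * (N - 1)) :=
  Nat.mul_le_mul_left _ (hNK.trans (Nat.le_mul_of_pos_right _ (by omega)))

/-- The message serving a surjective demand `d` with leaders `u` when user `k` caches, for each `m`,
the sum of the bits `(k, m)` of the files other than `m`. User `j` learns how its bits differ from
those of its leader `u (d j)`, and leader `u a` learns the bits `(u a, m)` of the files that it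
does not want, except those with `m = a`. Of the excepted bits, only the differences within each
file `n`, with `u (f n)` as the leader of reference, and one sum over all files are sent. -/
def sumComplMessage (d : Fin K → Fin N) (u : Fin N → Fin K) (f : Fin N → Fin N) :
    Finset (Functional N (Fin K × Fin N)) :=
  open Classical in
  (univ.offDiag ×ˢ (univ.image u)ᶜ).image
      (fun x => bit x.1.1 (x.2, x.1.2) - bit x.1.1 (u (d x.2), x.1.2)) ∪
    (univ.offDiag.sigma fun x => (univ.erase x.1).erase x.2).image
      (fun x => bit x.1.1 (u x.2, x.1.2)) ∪
    (univ.sigma fun n => (univ.erase n).erase (f n)).image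
      (fun x => bit x.1 (u x.2, x.2) - bit x.1 (u (f x.1), f x.1)) ∪
    {∑ n, bit n (u (f n), f n)}

theorem card_sumComplMessage_le (hN : 2 ≤ N) (hNK : N ≤ K) (d : Fin K → Fin N)
    {u : Fin N → Fin K} (hu : Function.Injective u) {f : Fin N → Fin N} (hf : ∀ n, f n ≠ n) :
    #(sumComplMessage d u f) ≤ N * (K * (N - 1)) - N * N + 1 := by
  classical
  have hpair {a b : Fin N} (h : b ≠ a) : #((univ.erase a).erase b) = N - 2 := by
    rw [card_erase_of_mem (mem_erase.2 ⟨h, mem_univ b⟩), card_erase_of_mem (mem_univ a), card_fin,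
      Nat.sub_sub]
  calc #(sumComplMessage d u f)
    _ ≤ (N * N - N) * (K - N) + (N * N - N) * (N - 2) + N * (N - 2) + 1 := by
      refine (card_union_le _ _).trans (add_le_add ((card_union_le _ _).trans (add_le_add
        ((card_union_le _ _).trans (add_le_add ?_ ?_)) ?_)) (card_singleton _).le) <;>
        refine card_image_le.trans ?_
      · simp [offDiag_card, card_compl, card_image_of_injective _ hu]
      · rw [card_sigma, sum_congr rfl fun x hx => hpair (mem_offDiag.1 hx).2.2.symm]
        simp [offDiag_card]
      · simp [card_sigma, hpair (hf _)]
    _ = N * (K * (N - 1)) - N * N + 1 := by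
      zify [mul_self_le_mul_mul_pred hN hNK, hNK, hN, Nat.le_mul_self N, show 1 ≤ N by omega]
      ring

theorem eq_zero_of_sumComplMessage_eq_zero {d : Fin K → Fin N} {u : Fin N → Fin K}
    (hu : Function.RightInverse u d) {f : Fin N → Fin N} {W : Fin N → Fin K × Fin N → ZMod 2}
    (hdiag : ∀ n j, W n (j, n) = 0) (hm : ∀ g ∈ sumComplMessage d u f, g W = 0) {k : Fin K}
    (hsum : ∀ m, ∑ n, W n (k, m) = 0) : W (d k) = 0 := by
  classical
  obtain ⟨hm, hE⟩ := forall_mem_union.1 hm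
  obtain ⟨hm, hrows⟩ := forall_mem_union.1 hm
  obtain ⟨hclones, hleaders⟩ := forall_mem_union.1 hm
  suffices h : (fun n j m => W n (j, m)) (d k) = 0 from
    funext fun x => congrFun (congrFun h x.1) x.2
  refine eq_zero_of_sum_compl_eq_zero (X := fun n j m => W n (j, m)) (u := u)
    (E := fun n => W n (u (f n), f n)) hdiag (fun n j m => ?_) (fun n a m han ham => ?_)
    (fun n a han => ?_) (by simpa using hE) hsum
  · by_cases hj : j ∈ univ.image u
    · obtain ⟨a, -, rfl⟩ := mem_image.1 hj
      rw [hu]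
    · rcases eq_or_ne n m with rfl | hnm
      · rw [hdiag, hdiag]
      · exact sub_eq_zero.1 (forall_mem_image.1 hclones (x := ((n, m), j))
          (by simpa [hnm] using hj))
  · rcases eq_or_ne n m with rfl | hnm
    · exact hdiag _ _
    · exact forall_mem_image.1 hleaders (x := ⟨(n, m), a⟩) (by simp [hnm, han, ham])
  · rcases eq_or_ne a (f n) with rfl | haf
    · rfl
    · exact sub_eq_zero.1 (forall_mem_image.1 hrows (x := ⟨n, a⟩) (by simp [haf, han]))

theorem linearScheme_sum_compl (hN : 2 ≤ N) (hNK : N < K) :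
    LinearScheme N K (K * (N - 1)) N (N * (K * (N - 1)) - N * N + 1) := by
  classical
  have : Nontrivial (Fin N) := Fin.nontrivial_iff_two_le.2 hN
  choose f hf using fun n : Fin N => exists_ne n
  have hS (n : Fin N) : #((univ : Finset (Fin K)) ×ˢ univ.erase n) = K * (N - 1) := by simp
  refine ⟨Fin K × Fin N, fun n => univ ×ˢ univ.erase n,
    fun k => univ.image fun m => ∑ n, bit n (k, m), hS,
    fun k => card_image_le.trans (by simp), fun d => ?_⟩
  by_cases hd : Function.Surjective d
  swap
  · refine delivers_of_not_surjective _ _ hS ?_ hd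
    have : N * N ≤ K * (N - 1) + 1 :=
      calc N * N = (N + 1) * (N - 1) + 1 := by
            zify [show 1 ≤ N by omega]
            ring
        _ ≤ K * (N - 1) + 1 := by gcongr; omega
    rw [Nat.sub_mul, one_mul]
    omega
  obtain ⟨u, hu⟩ := hd.hasRightInverse
  exact ⟨sumComplMessage d u f, card_sumComplMessage_le hN hNK.le d hu.injective hf,
    fun W hW k hc hm => eq_zero_of_sumComplMessage_eq_zero hu
      (fun n j => hW n (j, n) (by simp)) hm
      fun m => by simpa using forall_mem_image.1 hc (mem_univ m)⟩

end Schemes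

theorem sumPoint_mem_linearRegion {N K : ℕ} (hK : 0 < K) (hNK : N ≤ K) :
    (1 / (K : ℝ), (N : ℝ) - N / K) ∈ linearRegion N K := by
  refine ⟨_, _, _, hK, linearScheme_sum hNK, le_of_eq ?_, le_of_eq ?_⟩
  · rw [mul_one_div_cancel (by positivity), Nat.cast_one]
  · rw [Nat.cast_sub (Nat.le_mul_of_pos_right _ hK)]
    push_cast
    field_simp

theorem pairsPoint_mem_linearRegion {N K : ℕ} (hK : 0 < K) (hNK : N ≤ K) :
    ((N : ℝ) / K, (N : ℝ) - N * (N + 1) / (2 * K)) ∈ linearRegion N K := by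
  refine ⟨_, _, _, hK, linearScheme_pairs hNK, le_of_eq ?_, le_of_eq ?_⟩
  · rw [mul_div_cancel₀ _ (by positivity)]
  · rw [Nat.cast_sub (Nat.choose_le_choose _ (Nat.sub_le _ _)), Nat.cast_choose_two,
      Nat.cast_choose_two, Nat.cast_sub hNK]
    field_simp
    ring

theorem subsetsPoint_mem_linearRegion (N : ℕ) {K t : ℕ} (ht : 1 ≤ t) (htK : t ≤ K) :
    ((t : ℝ) * N / K, ((K : ℝ) - t) / (t + 1)) ∈ linearRegion N K := by
  refine ⟨_, _, _, Nat.choose_pos htK, linearScheme_subsets N K t, le_of_eq ?_, le_of_eq ?_⟩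
  · obtain ⟨t, rfl⟩ := Nat.exists_eq_add_of_le' ht
    obtain ⟨K, rfl⟩ := Nat.exists_eq_add_of_le' (ht.trans htK)
    have h : ((K + 1 : ℕ) : ℝ) * K.choose t = (K + 1).choose (t + 1) * (t + 1 : ℕ) := by
      exact_mod_cast Nat.add_one_mul_choose_eq K t
    rw [Nat.add_sub_cancel, Nat.add_sub_cancel, mul_div_assoc', eq_div_iff (by positivity),
      Nat.cast_mul]
    linear_combination (N : ℝ) * h
  · have h : (K.choose (t + 1) : ℝ) * (t + 1 : ℕ) = K.choose t * (K - t : ℕ) := by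
      exact_mod_cast Nat.choose_succ_right_eq K t
    rw [Nat.cast_sub htK, Nat.cast_add_one] at h
    rw [mul_div_assoc', eq_div_iff (by positivity), h]

theorem mem_interior_linearRegion_of_sum_compl_lt {N K : ℕ} (hN : 2 ≤ N) (hNK : N < K) {x : ℝ × ℝ}
    (hM : (N : ℝ) / (K * (N - 1)) < x.1) (hR : (N : ℝ) - (N + 1) / K < x.2) :
    x ∈ interior (linearRegion N K) := by
  have hN₁ : (0 : ℝ) < N - 1 := sub_pos.2 (by exact_mod_cast hN)
  have hK : (0 : ℝ) < K := by exact_mod_cast (Nat.zero_le N).trans_lt hNK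
  have hp : ((K * (N - 1) : ℕ) : ℝ) = K * (N - 1) := by
    push_cast [show 1 ≤ N by omega]
    rfl
  refine (linearScheme_sum_compl hN hNK).mem_interior_linearRegion
    (Nat.mul_pos (by omega) (by omega)) ?_ ?_
  · rwa [hp, ← div_lt_iff₀' (by positivity)]
  · rw [Nat.cast_add, Nat.cast_sub (mul_self_le_mul_mul_pred hN hNK.le), Nat.cast_mul N, hp]
    calc ((N * (K * (N - 1)) - (N * N : ℕ) + (1 : ℕ) : ℝ))
        = K * (N - 1) * (N - (N + 1) / K) := by
          push_cast
          field_simp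
          ring
      _ < K * (N - 1) * x.2 := by gcongr

section Corner

variable {N K t : ℕ}

/-- The line of slope `s` through the breakpoint `((N - 1) / K, N - N ^ 2 / (2 K))` of the
trade-off. -/
noncomputable def cornerLine (N K : ℕ) (s M : ℝ) : ℝ :=
  (N : ℝ) - (N : ℝ) ^ 2 / (2 * K) + s * (M - ((N : ℝ) - 1) / K)

/-- The slope of the trade-off to the right of its breakpoint. -/
noncomputable def rightSlope (N K t : ℕ) : ℝ :=
  1 / (((t : ℝ) - 1) * N + 1) * ((K * (K - t) : ℝ) / (t + 1) - N * (K - (N : ℝ) / 2))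

theorem tradeoff_of_le {M : ℝ} (hK : 0 < K) (hM : M ≤ ((N : ℝ) - 1) / K) :
    tradeoff N K t M = cornerLine N K (-N / 2) M := by
  rw [tradeoff, if_pos hM, cornerLine]
  field_simp
  ring

theorem tradeoff_of_lt {M : ℝ} (hM : ((N : ℝ) - 1) / K < M) :
    tradeoff N K t M = cornerLine N K (rightSlope N K t) M := by
  rw [tradeoff, if_neg hM.not_ge, cornerLine, rightSlope]
  ring

theorem cornerLine_corner (N K : ℕ) (s s' : ℝ) :
    cornerLine N K s (((N : ℝ) - 1) / K) = cornerLine N K s' (((N : ℝ) - 1) / K) := by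
  simp only [cornerLine, sub_self, mul_zero]

theorem cornerLine_one_div (N : ℕ) (hK : 0 < K) :
    cornerLine N K (-N / 2) (1 / K) = N - N / K := by
  rw [cornerLine]
  field_simp
  ring

theorem cornerLine_div (N : ℕ) (hK : 0 < K) :
    cornerLine N K (-N / 2) (N / K) = N - N * (N + 1) / (2 * K) := by
  rw [cornerLine]
  field_simp
  ring

theorem cornerLine_rightSlope (N : ℕ) (ht : 1 ≤ t) (hK : 0 < K) :
    cornerLine N K (rightSlope N K t) (t * N / K) = (K - t) / (t + 1) := by
  have hden : (0 : ℝ) < (t - 1) * N + 1 := by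
    have : (1 : ℝ) ≤ t := by exact_mod_cast ht
    nlinarith [N.cast_nonneg (α := ℝ)]
  have hdist : (t * N / K - (N - 1) / K : ℝ) = ((t - 1) * N + 1) / K := by ring
  rw [cornerLine, rightSlope, hdist, mul_div_assoc', one_div, mul_right_comm,
    inv_mul_cancel₀ hden.ne', one_mul]
  field_simp
  ring

theorem cornerLine_mem_interior_linearRegion (hN : 3 ≤ N) (hNK : N < K) {z : ℝ}
    (hz : z ∈ Set.Ioo (1 / (K : ℝ)) (N / K)) :
    (z, cornerLine N K (-N / 2) z) ∈ interior (linearRegion N K) := by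
  have hK : 0 < K := by omega
  have hN' : (3 : ℝ) ≤ N := by exact_mod_cast hN
  obtain ⟨x, hMx, hx⟩ : ∃ x : ℝ, (N : ℝ) / (K * (N - 1)) < x ∧ x < (N + 2) / (K * N) := by
    refine exists_between ?_
    have : (0 : ℝ) < N - 1 := by linarith
    rw [div_lt_div_iff₀ (by positivity) (by positivity)]
    have : (0 : ℝ) < K * (N - 2) := mul_pos (by positivity) (by linarith)
    linarith
  have hRx : (N : ℝ) - (N + 1) / K < cornerLine N K (-N / 2) x := by
    calc (N : ℝ) - (N + 1) / K = cornerLine N K (-N / 2) ((N + 2) / (K * N)) := by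
          rw [cornerLine]
          field_simp
          ring
      _ < cornerLine N K (-N / 2) x := by
          rw [cornerLine, cornerLine]
          nlinarith
  have hsum := sumPoint_mem_linearRegion hK hNK.le
  have hpairs := pairsPoint_mem_linearRegion hK hNK.le
  rw [← cornerLine_one_div N hK] at hsum
  rw [← cornerLine_div N hK] at hpairs
  exact mem_interior_of_convex_rat_of_line (convex_rat_linearRegion N K) hsum hpairs
    (mem_interior_linearRegion_of_sum_compl_lt (by omega) hNK hMx hRx) hz

theorem corner_mem_Ioo (hN : 3 ≤ N) (hK : 0 < K) :
    ((N : ℝ) - 1) / K ∈ Set.Ioo (1 / (K : ℝ)) (N / K) := by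
  have : (3 : ℝ) ≤ N := by exact_mod_cast hN
  constructor <;> gcongr <;> linarith

theorem cornerLine_left_mem_linearRegion (hN : 3 ≤ N) (hNK : N < K) {M : ℝ}
    (hM : M ∈ Set.Icc (1 / (K : ℝ)) ((N - 1) / K)) :
    (M, cornerLine N K (-N / 2) M) ∈ linearRegion N K := by
  have hK : 0 < K := by omega
  rcases hM.1.eq_or_lt with rfl | hlt
  · rw [cornerLine_one_div N hK]
    exact sumPoint_mem_linearRegion hK hNK.le
  · exact interior_subset (cornerLine_mem_interior_linearRegion hN hNK
      ⟨hlt, hM.2.trans_lt (corner_mem_Ioo hN hK).2⟩)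

theorem cornerLine_right_mem_linearRegion (hN : 3 ≤ N) (hNK : N < K) (ht : 1 ≤ t) (htK : t ≤ K)
    {M : ℝ} (hM : M ∈ Set.Ioc (((N : ℝ) - 1) / K) (t * N / K)) :
    (M, cornerLine N K (rightSlope N K t) M) ∈ linearRegion N K := by
  have hK : 0 < K := by omega
  have hend := subsetsPoint_mem_linearRegion N ht htK
  rw [← cornerLine_rightSlope N ht hK] at hend
  rcases hM.2.eq_or_lt with rfl | hlt
  · exact hend
  · have hcorner := cornerLine_mem_interior_linearRegion hN hNK (corner_mem_Ioo hN hK)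
    rw [cornerLine_corner N K _ (rightSlope N K t)] at hcorner
    exact interior_subset (mem_interior_of_convex_rat_of_line (convex_rat_linearRegion N K)
      (interior_subset hcorner) hend hcorner ⟨hM.1, hlt⟩)

end Corner

end CodedCaching

open CodedCaching in
theorem corollary1_general (N K : ℕ) (hN : 3 ≤ N) (hNK : N < K) (t : ℕ) (htK : t ≤ K)
    (M : ℝ) (hM₁ : 1 / (K : ℝ) ≤ M) (hM₂ : M ≤ (t : ℝ) * N / K) :
    Achievable N K (tradeoff N K t M) M := by
  have hK : 0 < K := by omega
  have ht : 1 ≤ t := Nat.one_le_iff_ne_zero.2 fun ht₀ => by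
    have hK' : 0 < 1 / (K : ℝ) := by positivity
    simp only [ht₀, Nat.cast_zero, zero_mul, zero_div] at hM₂
    linarith
  apply achievable_of_mem_linearRegion
  rcases le_or_gt M (((N : ℝ) - 1) / K) with hM | hM
  · rw [tradeoff_of_le hK hM]
    exact cornerLine_left_mem_linearRegion hN hNK ⟨hM₁, hM⟩
  · rw [tradeoff_of_lt hM]
    exact cornerLine_right_mem_linearRegion hN hNK ht htK ⟨hM, hM₂⟩

theorem corollary1 (N K : ℕ) (hN : 3 ≤ N) (hNK : N < K)
    (t : ℕ) (ht : CodedCaching.IsOptimalIndex N K t)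
    (M : ℝ) (hM₁ : 1 / (K : ℝ) ≤ M) (hM₂ : M ≤ (t : ℝ) * N / K) :
    CodedCaching.Achievable N K (CodedCaching.tradeoff N K t M) M :=
  corollary1_general N K hN hNK t (Finset.mem_Icc.1 ht.1).2 M hM₁ hM₂
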